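/- Let $\mathcal S$ be a complete separable metric space and let $\mu$ be a boundedly finite Borel measure on $\mathcal S$ (finite on bounded sets). Let $\widehat{\mathcal N}_{\mathcal S}$ be the space of boundedly finite integer-valued Borel measures on $\mathcal S$, with the coarsest topology making $\nu\mapsto\int f\,d\nu$ continuous for every bounded continuous $f:\mathcal S\to\mathbb R$ that vanishes outside a bounded set, and with its Borel $\sigma$-algebra. A point process is a random element of $\widehat{\mathcal N}_{\mathcal S}$. For $a,c>0$, a negative binomial process with parameters $a$ and $c$ (and parameter measure $\mu$) is a point process $N$ such that, for all pairwise disjoint bounded Borel sets $A_1,\dots,A_l$ and all integers $n_1,\dots,n_l\ge 0$, $$P\{N(A_i)=n_i,\ i=1,\dots,l\}=\frac{\Gamma\left(a+\sum_i n_i\right)}{\Gamma(a)}\left(\frac{c}{c+\sum_j\mu(A_j)}\right)^{a}\prod_{i=1}^{l}\frac{1}{n_i!}\left(\frac{\mu(A_i)}{c+\sum_j\mu(A_j)}\right)^{n_i},$$ that is, with joint probability generating function $\left(1+\frac1c\sum_i(1-z_i)\mu(A_i)\right)^{-a}$. For $\lambda>0$, a Poisson process with parameter $\lambda$ (and parameter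 measure $\mu$) is a point process $M$ such that, for such $A_i$, the counts $M(A_i)$ are independent and Poisson distributed with means $\lambda\mu(A_i)$. Theorem. Let $\lambda>0$ and, for every $c>0$, let $N_c$ be a negative binomial process with parameters $a=\lambda c$ and $c$ (and parameter measure $\mu$). Then a Poisson process $M$ with parameter $\lambda$ (and parameter measure $\mu$) exists, and, as $c\to\infty$, $N_c$ converges weakly to $M$, i.e. the laws of $N_c$ converge weakly, as probability measures on $\widehat{\mathcal N}_{\mathcal S}$, to the law of $M$. -/

import Mathlib

open MeasureTheory ProbabilityTheory Filter Topology Set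
open scoped BoundedContinuousFunction Nat

/-- A measure is boundedly finite if it is finite on every bounded set. -/
def BoundedlyFinite {S : Type*} [MetricSpace S] [MeasurableSpace S] (μ : Measure S) : Prop :=
  ∀ A : Set S, Bornology.IsBounded A → μ A < ⊤

/-- The space of boundedly finite, integer-valued measures on `S`
(the value on an unbounded Borel set may be infinite). -/
@[ext]
structure PointMeasure (S : Type*) [MetricSpace S] [MeasurableSpace S] where
  toMeasure : Measure S
  boundedlyFinite : BoundedlyFinite toMeasure
  integerValued : ∀ A : Set S, MeasurableSet A → Bornology.IsBounded A →
    ∃ n : ℕ, toMeasure A = n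

/-- The usual (weak-hash) topology on boundedly finite measures: the coarsest one
for which `ν ↦ ∫ f dν` is continuous for every bounded continuous `f` that vanishes outside
a bounded set. -/
noncomputable instance PointMeasure.instTopologicalSpace {S : Type*} [MetricSpace S]
    [MeasurableSpace S] : TopologicalSpace (PointMeasure S) :=
  ⨅ f : {f : S →ᵇ ℝ // Bornology.IsBounded (Function.support f)},
    TopologicalSpace.induced (fun ν : PointMeasure S => ∫ x, f.1 x ∂ν.toMeasure) inferInstance

/-- The Borel σ-algebra of the space of boundedly finite, integer-valued measures. -/
noncomputable instance PointMeasure.instMeasurableSpace {S : Type*} [MetricSpace S]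
    [MeasurableSpace S] : MeasurableSpace (PointMeasure S) :=
  borel (PointMeasure S)

instance PointMeasure.instBorelSpace {S : Type*} [MetricSpace S] [MeasurableSpace S] :
    BorelSpace (PointMeasure S) :=
  ⟨rfl⟩

/-- `N` is a point process on `S`, defined on the probability space `(Ω, P)`, with
finite-dimensional distributions `p`: for pairwise disjoint bounded Borel sets `A₁, …, A_l`
and natural numbers `n₁, …, n_l`, the probability that `N(A_i) = n_i` for all `i` is `p l A n`. -/
structure IsPointProcessWithFidi {S : Type*} [MetricSpace S] [MeasurableSpace S]
    {Ω : Type*} [MeasurableSpace Ω] (N : Ω → PointMeasure S) (P : Measure Ω)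
    (p : (l : ℕ) → (Fin l → Set S) → (Fin l → ℕ) → ℝ) : Prop where
  measurable : Measurable N
  fidi : ∀ (l : ℕ) (A : Fin l → Set S), (∀ i, MeasurableSet (A i)) →
    (∀ i, Bornology.IsBounded (A i)) → Pairwise (fun i j => Disjoint (A i) (A j)) →
    ∀ n : Fin l → ℕ, P.real {ω | ∀ i, (N ω).toMeasure (A i) = (n i : ENNReal)} = p l A n

/-- The negative binomial process with parameters `a`, `c` and parameter measure `μ`: with
`a_(n) = Γ(a + n) / Γ(a)`, the finite-dimensional distributions are
`P(N(A_i) = n_i, i ≤ l) = a_(∑ n_i) (c / (c + ∑ μ(A_j)))^a ∏ (μ(A_i) / (c + ∑ μ(A_j)))^(n_i) / n_i!`,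
that is, those with probability generating function
`(1 + ∑ (1 - z_i) μ(A_i) / c)^(-a)`. -/
def IsNegativeBinomialProcess {S : Type*} [MetricSpace S] [MeasurableSpace S]
    {Ω : Type*} [MeasurableSpace Ω] (N : Ω → PointMeasure S) (P : Measure Ω)
    (a c : ℝ) (μ : Measure S) : Prop :=
  IsPointProcessWithFidi N P fun _ A n =>
    Real.Gamma (a + ((∑ i, n i : ℕ) : ℝ)) / Real.Gamma a *
      (c / (c + ∑ j, μ.real (A j))) ^ a *
      ∏ i, (μ.real (A i) / (c + ∑ j, μ.real (A j))) ^ n i / ((n i)! : ℝ)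

/-- The Poisson process with parameter `lam` and parameter measure `μ`: the counts of pairwise
disjoint bounded Borel sets `A_i` are independent and Poisson distributed
with means `lam * μ(A_i)`. -/
def IsPoissonProcess {S : Type*} [MetricSpace S] [MeasurableSpace S]
    {Ω : Type*} [MeasurableSpace Ω] (N : Ω → PointMeasure S) (P : Measure Ω)
    (lam : ℝ) (μ : Measure S) : Prop :=
  IsPointProcessWithFidi N P fun _ A n =>
    ∏ i, Real.exp (-(lam * μ.real (A i))) * (lam * μ.real (A i)) ^ n i / ((n i)! : ℝ)

/-!
Both laws assign to a partition of a bounded Borel set `B` into cells `A i` with counts `n i`, of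
total `k`, a probability proportional to `∏ μ(A i) ^ n i / n i !`. Hence their ratio
`negBinPoissonRatio lam (μ B) k c` depends on `k` but not on the partition, and by a π-λ argument
(`measure_inter_eq_mul_of_partition`) the law of `N c` is this multiple of the law of `M` on all
events that depend only on the restriction of the point measure to `B`, within `{ν B = k}`. The
ratio tends to `1` as `c → ∞` (`tendsto_negBinPoissonRatio`), so that `liminf P(N c ∈ E) ≥ P(M ∈ E)`
for all such local events `E`.

The weak topology on point measures is generated by countably many integrals: every nonnegative
lower semicontinuous function is a supremum of finite suprema of rational cones
`x ↦ (q - p d(x, x_k))⁺` centred at the points of a dense sequence (`iSup_coneSup_eq`), and this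
makes the integrals of all bounded continuous functions with bounded support continuous in those of
the finite suprema of cones (`continuous_integral_of_coneSup`). So the space is second countable,
its Borel σ-algebra is generated by the evaluations `ν ↦ ν A`, and every open set is an increasing
union of local events (`IsOpen.exists_iUnion_localSigma`). Hence `liminf P(N c ∈ G) ≥ P(M ∈ G)` for
every open `G`, which is weak convergence by the portmanteau theorem, without any
tightness argument.

The Poisson process is built from independent pieces on the annuli `k ≤ d(x, x₀) < k + 1`, each a
Poisson number of independent points. The joint law of the counts is identified through its
characteristic function (`map_superpose_eq_pi`).
-/

open scoped NNReal ENNReal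

/-! ### Rational cones -/

namespace PointMeasure

section Cones

variable {S : Type*} [MetricSpace S] [TopologicalSpace.SeparableSpace S] [Nonempty S]

/-- The rational cones `x ↦ (q - (p + 1) d(x, x_k))⁺` over a dense sequence `x_k`, indexed by
`(k, p, q)`. The subtraction is the truncated one of `ℝ≥0`. -/
noncomputable def cone (i : ℕ × ℕ × ℚ≥0) (x : S) : ℝ≥0 :=
  (i.2.2 : ℝ≥0) - ((i.2.1 : ℝ≥0) + 1) * nndist x (TopologicalSpace.denseSeq S i.1)

/-- Finite suprema of rational cones, a countable family of bounded continuous functions with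
bounded support. -/
noncomputable def coneSup (s : Finset (ℕ × ℕ × ℚ≥0)) (x : S) : ℝ≥0 :=
  s.sup fun i => cone i x

lemma continuous_cone (i : ℕ × ℕ × ℚ≥0) : Continuous (cone i : S → ℝ≥0) := by
  unfold cone
  fun_prop

lemma continuous_coneSup (s : Finset (ℕ × ℕ × ℚ≥0)) : Continuous (coneSup s : S → ℝ≥0) := by
  unfold coneSup
  exact Continuous.finset_sup_apply fun i _ => continuous_cone i

lemma coneSup_le (s : Finset (ℕ × ℕ × ℚ≥0)) (x : S) :
    coneSup s x ≤ s.sup fun i => (i.2.2 : ℝ≥0) :=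
  Finset.sup_mono_fun fun _ _ => tsub_le_self

lemma isBounded_support_coneSup (s : Finset (ℕ × ℕ × ℚ≥0)) :
    Bornology.IsBounded (Function.support fun x : S => (coneSup s x : ℝ)) := by
  have : Function.support (fun x : S => (coneSup s x : ℝ)) ⊆
      ⋃ i ∈ s, Metric.ball (TopologicalSpace.denseSeq S i.1) (i.2.2 : ℝ≥0) := by
    intro x hx
    have h0 : 0 < coneSup s x := by
      rw [pos_iff_ne_zero]
      simpa using hx
    rw [coneSup, Finset.lt_sup_iff] at h0
    obtain ⟨i, his, hi⟩ := h0
    refine mem_iUnion₂.2 ⟨i, his, ?_⟩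
    rw [cone, tsub_pos_iff_lt] at hi
    have h1 : nndist x (TopologicalSpace.denseSeq S i.1) ≤
        ((i.2.1 : ℝ≥0) + 1) * nndist x (TopologicalSpace.denseSeq S i.1) :=
      le_mul_of_one_le_left zero_le (by simp)
    have h2 := h1.trans_lt hi
    rw [Metric.mem_ball]
    exact_mod_cast h2
  refine Bornology.IsBounded.subset ?_ this
  exact (Bornology.isBounded_biUnion s.finite_toSet).2 fun i _ => Metric.isBounded_ball

/-- A finite supremum of rational cones as a bounded continuous function. -/
noncomputable def coneSupBCF (s : Finset (ℕ × ℕ × ℚ≥0)) : S →ᵇ ℝ :=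
  BoundedContinuousFunction.ofNormedAddCommGroup (fun x => (coneSup s x : ℝ))
    (NNReal.continuous_coe.comp (continuous_coneSup s)) ((s.sup fun i => (i.2.2 : ℝ≥0) : ℝ≥0) : ℝ)
    fun x => by
      rw [Real.norm_eq_abs, NNReal.abs_eq]
      exact_mod_cast coneSup_le s x

lemma exists_abs_le_coneSupBCF (f : S →ᵇ ℝ) (hf : Bornology.IsBounded (Function.support f)) :
    ∃ s, ∀ x, |f x| ≤ coneSupBCF s x := by
  obtain ⟨R, hR⟩ := hf.subset_closedBall (TopologicalSpace.denseSeq S 0)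
  obtain ⟨p, hp⟩ := exists_nat_ge ‖f‖
  obtain ⟨r, hr⟩ := exists_nat_ge R
  refine ⟨{(0, p, (((p + 1) * (r + 1) : ℕ) : ℚ≥0))}, fun x => ?_⟩
  by_cases hx : f x = 0
  · rw [hx, abs_zero]
    exact NNReal.coe_nonneg _
  have h1 : dist x (TopologicalSpace.denseSeq S 0) ≤ r := (hR hx).trans hr
  have h2 : |f x| ≤ p := (f.norm_coe_le_norm x).trans hp
  have h3 : ((p : ℝ) + 1) * dist x (TopologicalSpace.denseSeq S 0) ≤ (p + 1) * r := by gcongr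
  refine h2.trans ?_
  have h4 : ((((p + 1) * (r + 1) : ℕ) : ℝ≥0) : ℝ) -
      (((p : ℝ≥0) + 1) * nndist x (TopologicalSpace.denseSeq S 0) : ℝ≥0) ≤
      cone (0, p, (((p + 1) * (r + 1) : ℕ) : ℚ≥0)) x := by
    rw [cone, NNReal.sub_def]
    simp only [NNRat.cast_natCast]
    exact Real.le_coe_toNNReal _
  have h5 : coneSupBCF {(0, p, (((p + 1) * (r + 1) : ℕ) : ℚ≥0))} x =
      (cone (0, p, (((p + 1) * (r + 1) : ℕ) : ℚ≥0)) x : ℝ) := by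
    simp [coneSupBCF, coneSup]
  rw [h5]
  refine le_trans ?_ h4
  push_cast
  linarith

/-- Every lower semicontinuous `h : S → [0, ∞]` is the supremum of the finite suprema of rational
cones below it; single cones already suffice pointwise. -/
lemma iSup_coneSup_eq {h : S → ℝ≥0∞} (hh : LowerSemicontinuous h) (x : S) :
    ⨆ s : {s : Finset (ℕ × ℕ × ℚ≥0) // ∀ x, (coneSup s x : ℝ≥0∞) ≤ h x},
      (coneSup s.1 x : ℝ≥0∞) = h x := by
  refine le_antisymm (iSup_le fun s => s.2 x) (le_of_forall_lt fun y hy => ?_)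
  obtain ⟨y, rfl⟩ : ∃ z : ℝ≥0, y = z := ⟨y.toNNReal, (ENNReal.coe_toNNReal hy.ne_top).symm⟩
  obtain ⟨q, hyq, hqh⟩ : ∃ q : ℚ≥0, y < (q : ℝ≥0) ∧ ((q : ℝ≥0) : ℝ≥0∞) < h x := by
    obtain ⟨z, hyz, hzh⟩ := ENNReal.lt_iff_exists_nnreal_btwn.1 hy
    obtain ⟨q, hq0, hyq, hqz⟩ := ENNReal.lt_iff_exists_rat_btwn.1 hyz
    refine ⟨⟨q, hq0⟩, ?_, lt_trans ?_ hzh⟩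
    · have : y < Real.toNNReal q := by exact_mod_cast hyq
      convert this using 1
      rw [← NNReal.coe_inj, Real.coe_toNNReal _ (by exact_mod_cast hq0)]
      rfl
    · convert hqz using 2
      rw [← NNReal.coe_inj, Real.coe_toNNReal _ (by exact_mod_cast hq0)]
      rfl
  obtain ⟨δ, hδ, hball⟩ := Metric.eventually_nhds_iff_ball.1 (hh x _ hqh)
  obtain ⟨p, hp⟩ := exists_nat_gt (2 * (q : ℝ≥0) / δ : ℝ)
  -- the centre is so close to `x` that the cone exceeds `y` at `x` and lives on `ball x δ`
  obtain ⟨k, hk⟩ : ∃ k, dist x (TopologicalSpace.denseSeq S k) <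
      min (δ / 2) (((q : ℝ≥0) - y : ℝ) / (p + 1)) := by
    have hpos : 0 < min (δ / 2) (((q : ℝ≥0) - y : ℝ) / (p + 1)) := by
      have : (y : ℝ) < (q : ℝ≥0) := by exact_mod_cast hyq
      refine lt_min (by positivity) (div_pos (by linarith) (by positivity))
    obtain ⟨z, hz, k, rfl⟩ :=
      (Metric.dense_iff.1 (TopologicalSpace.denseRange_denseSeq S) x _ hpos)
    exact ⟨k, by rwa [dist_comm]⟩
  have hone : ∀ z : S, coneSup {(k, p, q)} z = cone (k, p, q) z := fun z => by simp [coneSup]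
  have hle : ∀ z : S, (coneSup {(k, p, q)} z : ℝ≥0∞) ≤ h z := by
    intro z
    rw [hone]
    by_cases hz : z ∈ Metric.ball x δ
    · exact le_trans (by simp [cone]) (hball z hz).le
    · have : cone (k, p, q) z = 0 := by
        rw [cone, tsub_eq_zero_iff_le, ← NNReal.coe_le_coe]
        push_cast
        rw [Metric.mem_ball, not_lt] at hz
        have h1 : δ / 2 ≤ dist z (TopologicalSpace.denseSeq S k) := by
          have := dist_triangle z (TopologicalSpace.denseSeq S k) x
          rw [dist_comm (TopologicalSpace.denseSeq S k) x] at this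
          have := hk.trans_le (min_le_left _ _)
          linarith
        have h2 := (div_lt_iff₀ hδ).1 hp
        have h3 : (p : ℝ) * (δ / 2) ≤ (p + 1) * dist z (TopologicalSpace.denseSeq S k) := by
          gcongr
          linarith
        linarith
      simp [this]
  refine lt_iSup_iff.2 ⟨⟨{(k, p, q)}, hle⟩, ?_⟩
  simp only [hone]
  rw [ENNReal.coe_lt_coe, cone, lt_tsub_iff_right, ← NNReal.coe_lt_coe]
  push_cast
  have h2 := (lt_div_iff₀ (by positivity)).1 (hk.trans_le (min_le_right _ _))
  linarith

/-- The integral of a nonnegative lower semicontinuous function is the supremum of the integrals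
of the finite suprema of rational cones below it. -/
lemma lintegral_eq_iSup_coneSup [MeasurableSpace S] [BorelSpace S] (ν : Measure S)
    {h : S → ℝ≥0∞} (hh : LowerSemicontinuous h) :
    ∫⁻ x, h x ∂ν = ⨆ s : {s : Finset (ℕ × ℕ × ℚ≥0) // ∀ x, (coneSup s x : ℝ≥0∞) ≤ h x},
      ∫⁻ x, (coneSup s.1 x : ℝ≥0∞) ∂ν := by
  classical
  rw [← lintegral_iSup_directed]
  · exact lintegral_congr fun x => (iSup_coneSup_eq hh x).symm
  · exact fun s => ((continuous_coneSup _).measurable.coe_nnreal_ennreal).aemeasurable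
  · intro s t
    have key : ∀ x : S, coneSup (s.1 ∪ t.1) x = coneSup s.1 x ⊔ coneSup t.1 x :=
      fun x => Finset.sup_union
    refine ⟨⟨s.1 ∪ t.1, fun x => ?_⟩, fun x => ?_, fun x => ?_⟩
    · rw [key, ENNReal.coe_max]
      exact max_le (s.2 x) (t.2 x)
    · simp [key]
    · simp [key]

end Cones

end PointMeasure

/-! ### The topology and the Borel σ-algebra of the space of point measures -/

namespace PointMeasure

section Topology

variable {S : Type*} [MetricSpace S] [MeasurableSpace S] [BorelSpace S]

lemma integrable_of_isBounded_support (ν : PointMeasure S) (f : S →ᵇ ℝ)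
    (hf : Bornology.IsBounded (Function.support f)) : Integrable f ν.toMeasure := by
  rw [← integrableOn_iff_integrable_of_support_subset (Subset.refl (Function.support f))]
  exact Measure.integrableOn_of_bounded (M := ‖f‖) (ν.boundedlyFinite _ hf).ne
    f.continuous.aestronglyMeasurable (ae_of_all _ f.norm_coe_le_norm)

variable [TopologicalSpace.SeparableSpace S] [Nonempty S]

lemma integral_coneSupBCF (s : Finset (ℕ × ℕ × ℚ≥0)) (ν : Measure S) :
    ∫ x, coneSupBCF s x ∂ν = (∫⁻ x, (coneSup s x : ℝ≥0∞) ∂ν).toReal := by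
  rw [integral_eq_lintegral_of_nonneg_ae (f := coneSupBCF s)
    (ae_of_all _ fun x => NNReal.coe_nonneg _) (coneSupBCF s).continuous.aestronglyMeasurable]
  simp [coneSupBCF]

lemma lintegral_coneSup_eq_ofReal (s : Finset (ℕ × ℕ × ℚ≥0)) (ν : PointMeasure S) :
    ∫⁻ x, (coneSup s x : ℝ≥0∞) ∂ν.toMeasure =
      ENNReal.ofReal (∫ x, coneSupBCF s x ∂ν.toMeasure) := by
  rw [ofReal_integral_eq_lintegral_ofReal
    (integrable_of_isBounded_support ν _ (isBounded_support_coneSup s))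
    (ae_of_all _ fun x => NNReal.coe_nonneg _)]
  simp [coneSupBCF]

lemma lowerSemicontinuous_integral_of_coneSup {X : Type*} [TopologicalSpace X]
    {m : X → PointMeasure S}
    (hm : ∀ s, Continuous fun x => ∫ y, coneSupBCF s y ∂(m x).toMeasure)
    (f : S →ᵇ ℝ) (hf : Bornology.IsBounded (Function.support f)) (hf0 : ∀ y, 0 ≤ f y) :
    LowerSemicontinuous fun x => ∫ y, f y ∂(m x).toMeasure := by
  intro x a ha
  rcases lt_or_ge a 0 with ha0 | ha0
  · exact Eventually.of_forall fun z => ha0.trans_le (integral_nonneg hf0)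
  have hlsc : LowerSemicontinuous fun y => ENNReal.ofReal (f y) :=
    (ENNReal.continuous_ofReal.comp f.continuous).lowerSemicontinuous
  have h1 : ENNReal.ofReal a < ∫⁻ y, ENNReal.ofReal (f y) ∂(m x).toMeasure := by
    rw [← ofReal_integral_eq_lintegral_ofReal (integrable_of_isBounded_support _ f hf)
      (ae_of_all _ hf0)]
    exact (ENNReal.ofReal_lt_ofReal_iff (ha0.trans_lt ha)).2 ha
  rw [lintegral_eq_iSup_coneSup _ hlsc, lt_iSup_iff] at h1
  obtain ⟨s, hs⟩ := h1
  rw [lintegral_coneSup_eq_ofReal, ENNReal.ofReal_lt_ofReal_iff_of_nonneg ha0] at hs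
  filter_upwards [(hm s.1).continuousAt.eventually_const_lt hs] with z hz
  refine hz.trans_le (integral_mono
    (integrable_of_isBounded_support _ _ (isBounded_support_coneSup s.1))
    (integrable_of_isBounded_support _ f hf) fun y => ?_)
  have := s.2 y
  rw [ENNReal.ofReal, ENNReal.coe_le_coe, ← NNReal.coe_le_coe, Real.coe_toNNReal _ (hf0 y)] at this
  exact this

/-- Convergence of the integrals of all finite suprema of rational cones forces convergence of all
integrals that define the topology: `∫ f` is squeezed by the lower semicontinuity of `∫ (g + f)`
and of `∫ (g - f)`, where `g ≥ |f|` is itself a cone. -/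
lemma continuous_integral_of_coneSup {X : Type*} [TopologicalSpace X] {m : X → PointMeasure S}
    (hm : ∀ s, Continuous fun x => ∫ y, coneSupBCF s y ∂(m x).toMeasure)
    (f : S →ᵇ ℝ) (hf : Bornology.IsBounded (Function.support f)) :
    Continuous fun x => ∫ y, f y ∂(m x).toMeasure := by
  obtain ⟨s, hs⟩ := exists_abs_le_coneSupBCF f hf
  set g : S →ᵇ ℝ := coneSupBCF s
  have hg : Bornology.IsBounded (Function.support g) := isBounded_support_coneSup s
  have hadd : Bornology.IsBounded (Function.support (g + f)) :=
    (hg.union hf).subset (Function.support_add g f)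
  have hsub : Bornology.IsBounded (Function.support (g - f)) :=
    (hg.union hf).subset (Function.support_sub g f)
  have h1 := lowerSemicontinuous_integral_of_coneSup hm (g + f) hadd fun y => by
    have := neg_abs_le (f y)
    have := hs y
    simp only [BoundedContinuousFunction.coe_add, Pi.add_apply]
    linarith
  have h2 := lowerSemicontinuous_integral_of_coneSup hm (g - f) hsub fun y => by
    have := le_abs_self (f y)
    have := hs y
    simp only [BoundedContinuousFunction.coe_sub, Pi.sub_apply]
    linarith
  have e1 : ∀ x, ∫ y, (g + f) y ∂(m x).toMeasure + -∫ y, g y ∂(m x).toMeasure =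
      ∫ y, f y ∂(m x).toMeasure := fun x => by
    have := integral_add (integrable_of_isBounded_support (m x) g hg)
      (integrable_of_isBounded_support (m x) f hf)
    simp only [BoundedContinuousFunction.coe_add, Pi.add_apply, this]
    ring
  have e2 : ∀ x, -∫ y, (g - f) y ∂(m x).toMeasure + ∫ y, g y ∂(m x).toMeasure =
      ∫ y, f y ∂(m x).toMeasure := fun x => by
    have := integral_sub (integrable_of_isBounded_support (m x) g hg)
      (integrable_of_isBounded_support (m x) f hf)
    simp only [BoundedContinuousFunction.coe_sub, Pi.sub_apply, this]
    ring
  rw [continuous_iff_lower_upperSemicontinuous]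
  constructor
  · simp_rw [← e1]
    exact h1.add (hm s).neg.lowerSemicontinuous
  · simp_rw [← e2]
    refine UpperSemicontinuous.add (fun x a ha => ?_) (hm s).upperSemicontinuous
    filter_upwards [h2 x (-a) (by linarith)] with z hz
    linarith

lemma instTopologicalSpace_eq_iInf :
    (instTopologicalSpace : TopologicalSpace (PointMeasure S)) =
      ⨅ s, TopologicalSpace.induced
        (fun ν : PointMeasure S => ∫ x, coneSupBCF s x ∂ν.toMeasure) inferInstance := by
  refine le_antisymm (le_iInf fun s => iInf_le_of_le ⟨coneSupBCF s, isBounded_support_coneSup s⟩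
    le_rfl) (le_iInf fun f => ?_)
  rw [← continuous_iff_le_induced]
  refine @continuous_integral_of_coneSup S _ _ _ _ _ (PointMeasure S) (_) id (fun s => ?_) f.1 f.2
  rw [continuous_iff_le_induced]
  exact iInf_le _ s

lemma instTopologicalSpace_eq_induced :
    (instTopologicalSpace : TopologicalSpace (PointMeasure S)) =
      TopologicalSpace.induced
        (fun (ν : PointMeasure S) (s : Finset (ℕ × ℕ × ℚ≥0)) => ∫ x, coneSupBCF s x ∂ν.toMeasure)
        inferInstance := by
  rw [instTopologicalSpace_eq_iInf]
  simp only [Pi.topologicalSpace, induced_iInf, induced_compose, Function.comp_def]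

instance : SecondCountableTopology (PointMeasure S) := by
  rw [instTopologicalSpace_eq_induced]
  exact TopologicalSpace.secondCountableTopology_induced _ _ _

end Topology

section Measurability

variable {S : Type*} [MetricSpace S] [MeasurableSpace S] [BorelSpace S]
variable [TopologicalSpace.SeparableSpace S] [Nonempty S]

lemma measurable_lintegral_coneSup (s : Finset (ℕ × ℕ × ℚ≥0)) :
    Measurable fun ν : PointMeasure S => ∫⁻ x, (coneSup s x : ℝ≥0∞) ∂ν.toMeasure := by
  simp_rw [lintegral_coneSup_eq_ofReal]
  refine ENNReal.measurable_ofReal.comp (Continuous.measurable ?_)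
  rw [continuous_iff_le_induced]
  exact iInf_le_of_le ⟨coneSupBCF s, isBounded_support_coneSup s⟩ le_rfl

/-- The evaluations `ν ↦ ν A` are Borel measurable: for open `A` they are countable suprema of
continuous functions, and a π-λ argument on bounded balls extends this to all Borel sets. -/
lemma measurable_toMeasure : Measurable (toMeasure : PointMeasure S → Measure S) := by
  have hopen : ∀ U : Set S, IsOpen U → Measurable fun ν : PointMeasure S => ν.toMeasure U := by
    intro U hU
    have hlsc : LowerSemicontinuous (U.indicator fun _ => (1 : ℝ≥0∞)) :=
      hU.lowerSemicontinuous_indicator zero_le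
    have : ∀ ν : PointMeasure S, ν.toMeasure U = _ := fun ν =>
      (lintegral_indicator_one hU.measurableSet).symm.trans
        (lintegral_eq_iSup_coneSup ν.toMeasure hlsc)
    simp_rw [this]
    exact Measurable.iSup fun s => measurable_lintegral_coneSup s.1
  obtain ⟨x₀⟩ := ‹Nonempty S›
  have hball : ∀ n : ℕ, Measurable fun ν : PointMeasure S =>
      ν.toMeasure.restrict (Metric.ball x₀ n) := by
    intro n
    have : ∀ ν : PointMeasure S, IsFiniteMeasure (ν.toMeasure.restrict (Metric.ball x₀ n)) :=
      fun ν => ⟨by simpa using ν.boundedlyFinite _ Metric.isBounded_ball⟩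
    refine Measurable.measure_of_isPiSystem BorelSpace.measurable_eq
      isPiSystem_isOpen (fun U hU => ?_) ?_
    · simp_rw [Measure.restrict_apply (IsOpen.measurableSet hU)]
      exact hopen _ (IsOpen.inter hU Metric.isOpen_ball)
    · simp_rw [Measure.restrict_apply MeasurableSet.univ]
      exact hopen _ (isOpen_univ.inter Metric.isOpen_ball)
  refine Measure.measurable_of_measurable_coe _ fun A hA => ?_
  have : ∀ ν : PointMeasure S, ν.toMeasure A =
      ⨆ n : ℕ, (ν.toMeasure.restrict (Metric.ball x₀ n)) A := fun ν => by
    simp_rw [Measure.restrict_apply hA]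
    have hmono : Monotone fun n : ℕ => A ∩ Metric.ball x₀ n := fun a b hab =>
      inter_subset_inter_right _ (Metric.ball_subset_ball (by exact_mod_cast hab))
    rw [← hmono.measure_iUnion, ← inter_iUnion, Metric.iUnion_ball_nat, inter_univ]
  simp_rw [this]
  exact Measurable.iSup fun n => (Measure.measurable_coe hA).comp (hball n)

/-- The Borel σ-algebra is generated by the integrals of countably many functions, hence by the
evaluations `ν ↦ ν A`. -/
lemma measurable_of_measurable_toMeasure {Ω : Type*} [MeasurableSpace Ω]
    {N : Ω → PointMeasure S} (h : Measurable fun ω => (N ω).toMeasure) : Measurable N := by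
  have hb : (instMeasurableSpace : MeasurableSpace (PointMeasure S)) =
      MeasurableSpace.comap
        (fun (ν : PointMeasure S) (s : Finset (ℕ × ℕ × ℚ≥0)) => ∫ x, coneSupBCF s x ∂ν.toMeasure)
        inferInstance := by
    rw [instMeasurableSpace, instTopologicalSpace_eq_induced,
      BorelSpace.measurable_eq (α := Finset (ℕ × ℕ × ℚ≥0) → ℝ)]
    exact borel_comap
  rw [hb, measurable_comap_iff]
  refine measurable_pi_lambda _ fun s => ?_
  simp only [Function.comp_apply, integral_coneSupBCF]
  exact ((Measure.measurable_lintegral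
    (continuous_coneSup s).measurable.coe_nnreal_ennreal).comp h).ennreal_toReal

end Measurability

end PointMeasure

/-! ### Events that depend only on a bounded set -/

namespace PointMeasure

section LocalEvents

lemma measurable_restrict {α : Type*} [MeasurableSpace α] {B : Set α} (hB : MeasurableSet B) :
    Measurable fun m : Measure α => m.restrict B :=
  Measure.measurable_of_measurable_coe _ fun A hA => by
    simp_rw [Measure.restrict_apply hA]
    exact Measure.measurable_coe (hA.inter hB)

/-- The σ-algebra of the events that depend only on the restriction of the point measure to `B`. -/
noncomputable abbrev localSigma {S : Type*} [MetricSpace S] [MeasurableSpace S] (B : Set S) :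
    MeasurableSpace (PointMeasure S) :=
  MeasurableSpace.comap (fun ν => ν.toMeasure.restrict B) inferInstance

lemma localSigma_mono {S : Type*} [MetricSpace S] [MeasurableSpace S] {B C : Set S}
    (hB : MeasurableSet B) (h : B ⊆ C) : localSigma B ≤ localSigma C := by
  rw [localSigma, ← measurable_iff_comap_le]
  have : (fun ν : PointMeasure S => ν.toMeasure.restrict B) =
      (fun m : Measure S => m.restrict B) ∘ fun ν : PointMeasure S => ν.toMeasure.restrict C := by
    ext1 ν
    simp [Measure.restrict_restrict hB, inter_eq_left.2 h]
  rw [this]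
  exact (measurable_restrict hB).comp (comap_measurable _)

variable {S : Type*} [MetricSpace S] [MeasurableSpace S] [BorelSpace S]
variable [TopologicalSpace.SeparableSpace S] [Nonempty S]

lemma localSigma_le {B : Set S} (hB : MeasurableSet B) :
    localSigma B ≤ (instMeasurableSpace : MeasurableSpace (PointMeasure S)) := by
  rw [localSigma, ← measurable_iff_comap_le]
  exact (measurable_restrict hB).comp measurable_toMeasure

lemma measurable_localSigma_integral_coneSupBCF (s : Finset (ℕ × ℕ × ℚ≥0)) (x₀ : S) :
    ∃ n : ℕ, Measurable[localSigma (Metric.ball x₀ n)]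
      fun ν : PointMeasure S => ∫ x, coneSupBCF s x ∂ν.toMeasure := by
  obtain ⟨R, hR⟩ := (isBounded_support_coneSup (S := S) s).subset_ball x₀
  obtain ⟨n, hn⟩ := exists_nat_ge R
  refine ⟨n, ?_⟩
  have : ∀ ν : PointMeasure S, ∫ x, coneSupBCF s x ∂ν.toMeasure =
      (∫⁻ x, (coneSup s x : ℝ≥0∞) ∂(ν.toMeasure.restrict (Metric.ball x₀ n))).toReal := fun ν => by
    rw [← integral_coneSupBCF, setIntegral_eq_integral_of_forall_compl_eq_zero]
    intro x hx
    by_contra h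
    exact hx (Metric.ball_subset_ball hn (hR h))
  simp_rw [this]
  exact ((Measure.measurable_lintegral
    (continuous_coneSup s).measurable.coe_nnreal_ennreal).comp (comap_measurable _)).ennreal_toReal

/-- Every open set of point measures is an increasing union of events, each of which depends only
on the restriction of the point measure to some bounded ball. -/
lemma _root_.IsOpen.exists_iUnion_localSigma {G : Set (PointMeasure S)} (hG : IsOpen G) (x₀ : S) :
    ∃ E : ℕ → Set (PointMeasure S), Monotone E ∧ ⋃ k, E k = G ∧
      ∀ k, ∃ n : ℕ, MeasurableSet[localSigma (Metric.ball x₀ n)] (E k) := by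
  have hmono : ∀ {a b : ℕ}, a ≤ b →
      localSigma (Metric.ball x₀ a) ≤ localSigma (Metric.ball x₀ b) := fun hab =>
    localSigma_mono Metric.isOpen_ball.measurableSet
      (Metric.ball_subset_ball (by exact_mod_cast hab))
  have hbasis := IsTopologicalBasis.iInf_induced
    (fun _ : Finset (ℕ × ℕ × ℚ≥0) => TopologicalSpace.isTopologicalBasis_opens (α := ℝ))
    (fun s (ν : PointMeasure S) => ∫ x, coneSupBCF s x ∂ν.toMeasure)
  rw [← instTopologicalSpace_eq_iInf] at hbasis
  obtain ⟨𝒯, h𝒯, hGU⟩ := hbasis.open_eq_sUnion hG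
  obtain ⟨𝒯', h𝒯c, h𝒯', hU⟩ := TopologicalSpace.isOpen_sUnion_countable 𝒯
    fun U hU => hbasis.isOpen (h𝒯 hU)
  obtain ⟨f, hf⟩ := (h𝒯c.insert ∅).exists_eq_range (insert_nonempty _ _)
  have hloc : ∀ k, ∃ n : ℕ, MeasurableSet[localSigma (Metric.ball x₀ n)] (f k) := by
    intro k
    have hk : f k ∈ insert ∅ 𝒯' := hf ▸ mem_range_self k
    rcases hk with hk | hk
    · exact ⟨0, hk ▸ @MeasurableSet.empty _ (_)⟩
    obtain ⟨U, F, hUo, hfk⟩ := h𝒯 (h𝒯' hk)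
    choose n hn using fun s => measurable_localSigma_integral_coneSupBCF (S := S) s x₀
    refine ⟨F.sup n, hfk ▸ Finset.measurableSet_biInter F fun s hs => ?_⟩
    exact hmono (Finset.le_sup hs) _ (hn s (IsOpen.measurableSet (hUo s hs)))
  choose n hn using hloc
  refine ⟨accumulate f, monotone_accumulate, ?_, fun k => ⟨(Finset.range (k + 1)).sup n, ?_⟩⟩
  · rw [iUnion_accumulate, ← sUnion_range, ← hf, sUnion_insert, empty_union, hU, ← hGU]
  · rw [accumulate_def]
    exact MeasurableSet.biUnion (to_countable _) fun j hj =>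
      hmono (Finset.le_sup (Finset.mem_range.2 (Nat.lt_succ_of_le hj))) _ (hn j)

lemma measurableSet_forall_eq {ι : Type*} [Countable ι] {A : ι → Set S}
    (hA : ∀ i, MeasurableSet (A i)) (m : ι → ℕ) :
    MeasurableSet {ν : PointMeasure S | ∀ i, ν.toMeasure (A i) = (m i : ℝ≥0∞)} := by
  rw [ofPred_forall]
  exact MeasurableSet.iInter fun i =>
    ((Measure.measurable_coe (hA i)).comp measurable_toMeasure) (measurableSet_singleton _)

/-- An event about the values on the cells of a partition of `B` is a countable union of the events
that fix all these values. -/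
lemma measure_partition_eq_mul {Q₁ Q₂ : Measure (PointMeasure S)} {B : Set S}
    (hBb : Bornology.IsBounded B) {k : ℕ} {r : ℝ≥0∞} {ι : Type*} [Fintype ι] {A : ι → Set S}
    (hA : ∀ i, MeasurableSet (A i)) (hd : Pairwise fun i j => Disjoint (A i) (A j))
    (hU : ⋃ i, A i = B)
    (h : ∀ m : ι → ℕ, ∑ i, m i = k →
      Q₁ {ν | ∀ i, ν.toMeasure (A i) = (m i : ℝ≥0∞)} =
        r * Q₂ {ν | ∀ i, ν.toMeasure (A i) = (m i : ℝ≥0∞)})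
    (W : Set (ι → ℝ≥0∞)) :
    Q₁ {ν | (fun i => ν.toMeasure (A i)) ∈ W ∧ ν.toMeasure B = k} =
      r * Q₂ {ν | (fun i => ν.toMeasure (A i)) ∈ W ∧ ν.toMeasure B = k} := by
  set W' : Set (ι → ℕ) := {m | (fun i => (m i : ℝ≥0∞)) ∈ W ∧ ∑ i, m i = k}
  have hsum : ∀ ν : PointMeasure S, ν.toMeasure B = ∑ i, ν.toMeasure (A i) := fun ν => by
    rw [← hU, measure_iUnion hd hA, tsum_fintype]
  have hset : {ν : PointMeasure S | (fun i => ν.toMeasure (A i)) ∈ W ∧ ν.toMeasure B = k} =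
      ⋃ m ∈ W', {ν | ∀ i, ν.toMeasure (A i) = (m i : ℝ≥0∞)} := by
    ext ν
    simp only [mem_ofPred_eq, mem_iUnion, exists_prop]
    constructor
    · rintro ⟨h1, h2⟩
      choose m hm using fun i => ν.integerValued (A i) (hA i)
        (hBb.subset (hU ▸ subset_iUnion A i))
      refine ⟨m, ⟨?_, ?_⟩, hm⟩
      · simpa only [← hm] using h1
      · rw [hsum] at h2
        simp_rw [hm] at h2
        exact_mod_cast h2
    · rintro ⟨m, ⟨h1, h2⟩, hm⟩
      refine ⟨by simpa only [hm] using h1, ?_⟩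
      rw [hsum]
      simp_rw [hm]
      exact_mod_cast h2
  have hdis : W'.PairwiseDisjoint
      fun m => {ν : PointMeasure S | ∀ i, ν.toMeasure (A i) = (m i : ℝ≥0∞)} := by
    intro m _ m' _ hne
    rw [Function.onFun, Set.disjoint_left]
    intro ν h1 h2
    refine hne (funext fun i => ?_)
    exact_mod_cast (h1 i).symm.trans (h2 i)
  have hm := fun m (_ : m ∈ W') => measurableSet_forall_eq hA m
  rw [hset, measure_biUnion (to_countable _) hdis hm, measure_biUnion (to_countable _) hdis hm,
    ← ENNReal.tsum_mul_left]
  exact tsum_congr fun m => h m.1 m.2.2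

/-- If the finite-dimensional distributions of two laws over every partition of `B` into `l` cells
with total count `k` are proportional, with a factor `r` that does not depend on the partition, then
the two laws are proportional on all events that depend only on `B`, within `{ν B = k}`. -/
lemma measure_inter_eq_mul_of_partition {Q₁ Q₂ : Measure (PointMeasure S)}
    [IsFiniteMeasure Q₁] {B : Set S} (hB : MeasurableSet B)
    (hBb : Bornology.IsBounded B) {k : ℕ} {r : ℝ≥0∞}
    (h : ∀ (l : ℕ) (A : Fin l → Set S), (∀ i, MeasurableSet (A i)) →
      (Pairwise fun i j => Disjoint (A i) (A j)) → ⋃ i, A i = B →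
      ∀ m : Fin l → ℕ, ∑ i, m i = k →
      Q₁ {ν | ∀ i, ν.toMeasure (A i) = (m i : ℝ≥0∞)} =
        r * Q₂ {ν | ∀ i, ν.toMeasure (A i) = (m i : ℝ≥0∞)})
    {E : Set (PointMeasure S)} (hE : MeasurableSet[localSigma B] E) :
    Q₁ (E ∩ {ν | ν.toMeasure B = k}) = r * Q₂ (E ∩ {ν | ν.toMeasure B = k}) := by
  classical
  set T : Set (PointMeasure S) := {ν | ν.toMeasure B = k}
  -- finite intersections of conditions on the values `ν (A ∩ B)`
  have hcyl : ∀ (t : Finset {A : Set S // MeasurableSet A})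
      (V : {A : Set S // MeasurableSet A} → Set ℝ≥0∞),
      Q₁ ((⋂ A ∈ t, {ν | ν.toMeasure (A.1 ∩ B) ∈ V A}) ∩ T) =
        r * Q₂ ((⋂ A ∈ t, {ν | ν.toMeasure (A.1 ∩ B) ∈ V A}) ∩ T) := by
    intro t V
    -- `g` records to which sets of `t` a point belongs; its level sets in `B` are the cells
    let g : S → ({A // A ∈ t} → Bool) := fun y A => decide (y ∈ A.1.1)
    have hg : Measurable g := measurable_pi_lambda _ fun A => measurable_to_bool <| by
      convert! A.1.2 using 1
      ext y
      simp [g]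
    let e := Fintype.equivFin ({A // A ∈ t} → Bool)
    let C : Fin (Fintype.card ({A // A ∈ t} → Bool)) → Set S := fun i => B ∩ g ⁻¹' {e.symm i}
    have hC : ∀ i, MeasurableSet (C i) := fun i => hB.inter (hg (measurableSet_singleton _))
    have hCd : Pairwise fun i j => Disjoint (C i) (C j) := fun i j hij => by
      refine Set.disjoint_left.2 fun y hi hj => hij (e.symm.injective ?_)
      exact hi.2.symm.trans hj.2
    have hCU : ⋃ i, C i = B := by
      ext y
      simp only [C, mem_iUnion, mem_inter_iff, mem_preimage, mem_singleton_iff]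
      exact ⟨fun ⟨_, h, _⟩ => h, fun h => ⟨e (g y), h, by simp⟩⟩
    have hval : ∀ (ν : PointMeasure S) (A : {A // A ∈ t}), ν.toMeasure (A.1.1 ∩ B) =
        ∑ i with e.symm i A = true, ν.toMeasure (C i) := by
      intro ν A
      rw [← measure_biUnion_finset (fun i _ j _ hij => hCd hij) fun i _ => hC i]
      congr 1
      ext y
      simp only [C, mem_iUnion, mem_inter_iff, mem_preimage, mem_singleton_iff,
        Finset.mem_filter, Finset.mem_univ, true_and]
      constructor
      · rintro ⟨h1, h2⟩
        exact ⟨e (g y), by simpa [g] using h1, h2, by simp⟩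
      · rintro ⟨i, h1, h2, h3⟩
        rw [← h3] at h1
        exact ⟨by simpa [g] using h1, h2⟩
    have hset : (⋂ A ∈ t, {ν : PointMeasure S | ν.toMeasure (A.1 ∩ B) ∈ V A}) ∩ T =
        {ν | (fun i => ν.toMeasure (C i)) ∈ {w : Fin _ → ℝ≥0∞ |
          ∀ A : {A // A ∈ t}, ∑ i with e.symm i A = true, w i ∈ V A.1} ∧
            ν.toMeasure B = (k : ℝ≥0∞)} := by
      ext ν
      simp only [mem_inter_iff, mem_iInter, mem_ofPred_eq, T, ← hval, Subtype.forall]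
    rw [hset]
    exact measure_partition_eq_mul hBb hC hCd hCU (h _ C hC hCd hCU) _
  have hT : MeasurableSet T :=
    ((Measure.measurable_coe hB).comp measurable_toMeasure) (measurableSet_singleton _)
  let σ : {A : Set S // MeasurableSet A} → MeasurableSpace (PointMeasure S) := fun A =>
    MeasurableSpace.comap (fun ν => ν.toMeasure (A.1 ∩ B)) inferInstance
  have hgen : localSigma B = MeasurableSpace.generateFrom
      (piiUnionInter (fun A => {s | MeasurableSet[σ A] s}) univ) := by
    rw [generateFrom_piiUnionInter_measurableSet σ univ, localSigma, Measure.instMeasurableSpace]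
    simp only [MeasurableSpace.comap_iSup, MeasurableSpace.comap_comp, iSup_subtype, mem_univ,
      iSup_pos, σ]
    refine iSup_congr fun A => iSup_congr fun hA => ?_
    rw [BorelSpace.measurable_eq (α := ℝ≥0∞)]
    congr 1
    ext ν
    simp [Measure.restrict_apply hA]
  have hpi : IsPiSystem (piiUnionInter (fun A => {s | MeasurableSet[σ A] s}) univ) :=
    isPiSystem_piiUnionInter _ (fun A => @MeasurableSpace.isPiSystem_measurableSet _ (σ A)) _
  have key := ext_on_measurableSpace_of_generate_finite (μ := Q₁.restrict T)
    (ν := r • Q₂.restrict T) inferInstance _ ?_ (localSigma_le hB) hgen hpi ?_ hE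
  · rwa [Measure.smul_apply, smul_eq_mul, Measure.restrict_apply (localSigma_le hB _ hE),
      Measure.restrict_apply (localSigma_le hB _ hE)] at key
  · rintro s hs
    have hs' : MeasurableSet s := localSigma_le hB _
      (hgen ▸ MeasurableSpace.measurableSet_generateFrom hs)
    obtain ⟨t, -, f, hf, rfl⟩ := hs
    rw [Measure.smul_apply, smul_eq_mul, Measure.restrict_apply hs', Measure.restrict_apply hs']
    choose! V hV using hf
    have : ⋂ A ∈ t, f A = ⋂ A ∈ t, {ν : PointMeasure S | ν.toMeasure (A.1 ∩ B) ∈ V A} :=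
      iInter₂_congr fun A hA => (hV A hA).2.symm
    rw [this]
    exact hcyl t V
  · simpa [Measure.restrict_apply] using hcyl ∅ fun _ => univ

lemma measure_eq_tsum_inter (Q : Measure (PointMeasure S)) {B : Set S} (hB : MeasurableSet B)
    (hBb : Bornology.IsBounded B) {E : Set (PointMeasure S)} (hE : MeasurableSet E) :
    Q E = ∑' k : ℕ, Q (E ∩ {ν | ν.toMeasure B = k}) := by
  rw [← measure_iUnion]
  · congr 1
    ext ν
    simpa using fun _ => ν.integerValued B hB hBb
  · intro i j hij
    refine Set.disjoint_left.2 fun ν h1 h2 => hij ?_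
    exact_mod_cast h1.2.symm.trans h2.2
  · exact fun k => hE.inter
      (((Measure.measurable_coe hB).comp measurable_toMeasure) (measurableSet_singleton _))

end LocalEvents

end PointMeasure

/-! ### Convergence of negative binomial processes -/

namespace PointMeasure

section Convergence

variable {S : Type*} [MetricSpace S] [MeasurableSpace S] [BorelSpace S]
variable [TopologicalSpace.SeparableSpace S] [Nonempty S]

/-- Suppose that, for every bounded `B`, the finite-dimensional distributions of `Q c` over the
partitions of `B` with total count `k` are `r k c` times those of `Q₀`, where `r k c → 1` for each
`k`. Then `Q₀ G ≤ liminf Q c G` for every open `G`, stated here through eventual inequalities. -/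
lemma eventually_lt_measure_of_isOpen {ι : Type*} {L : Filter ι}
    {Q : ι → Measure (PointMeasure S)} [∀ c, IsFiniteMeasure (Q c)]
    {Q₀ : Measure (PointMeasure S)} [IsFiniteMeasure Q₀]
    (h : ∀ B : Set S, MeasurableSet B → Bornology.IsBounded B → ∃ r : ℕ → ι → ℝ≥0∞,
      (∀ k, Tendsto (r k) L (𝓝 1)) ∧ ∀ c k, ∀ (l : ℕ) (A : Fin l → Set S),
        (∀ i, MeasurableSet (A i)) → (Pairwise fun i j => Disjoint (A i) (A j)) →
        ⋃ i, A i = B → ∀ m : Fin l → ℕ, ∑ i, m i = k →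
        Q c {ν | ∀ i, ν.toMeasure (A i) = (m i : ℝ≥0∞)} =
          r k c * Q₀ {ν | ∀ i, ν.toMeasure (A i) = (m i : ℝ≥0∞)})
    {G : Set (PointMeasure S)} (hG : IsOpen G) {a : ℝ≥0∞} (ha : a < Q₀ G) :
    ∀ᶠ c in L, a < Q c G := by
  obtain ⟨x₀⟩ := ‹Nonempty S›
  have : Nonempty S := ⟨x₀⟩
  obtain ⟨E, hEmono, rfl, hE⟩ := hG.exists_iUnion_localSigma x₀
  rw [hEmono.measure_iUnion, lt_iSup_iff] at ha
  obtain ⟨j, hj⟩ := ha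
  obtain ⟨n, hn⟩ := hE j
  set B := Metric.ball x₀ (n : ℝ)
  have hB : MeasurableSet B := Metric.isOpen_ball.measurableSet
  have hBb : Bornology.IsBounded B := Metric.isBounded_ball
  obtain ⟨r, hr, hQ⟩ := h B hB hBb
  rw [measure_eq_tsum_inter Q₀ hB hBb (localSigma_le hB _ hn), ENNReal.tsum_eq_iSup_nat,
    lt_iSup_iff] at hj
  obtain ⟨K, hK⟩ := hj
  have hlim : Tendsto (fun c => ∑ k ∈ Finset.range K,
      r k c * Q₀ (E j ∩ {ν | ν.toMeasure B = (k : ℝ≥0∞)})) L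
      (𝓝 (∑ k ∈ Finset.range K, 1 * Q₀ (E j ∩ {ν | ν.toMeasure B = (k : ℝ≥0∞)}))) :=
    tendsto_finsetSum _ fun k _ =>
      ENNReal.Tendsto.mul_const (hr k) (Or.inr (measure_ne_top _ _))
  simp only [one_mul] at hlim
  filter_upwards [hlim.eventually_const_lt hK] with c hc
  refine hc.trans_le (le_trans ?_ (measure_mono (subset_iUnion E j)))
  rw [measure_eq_tsum_inter (Q c) hB hBb (localSigma_le hB _ hn)]
  refine le_trans (Finset.sum_le_sum fun k _ => ?_) (ENNReal.sum_le_tsum (Finset.range K))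
  exact (measure_inter_eq_mul_of_partition hB hBb (hQ c k) hn).ge

end Convergence

end PointMeasure

section Ratio

/-- The ratio of the negative binomial fidi with parameters `lam * c` and `c` to the Poisson fidi
with parameter `lam`, over a partition of a set of measure `m`, with total count `k`. -/
noncomputable def negBinPoissonRatio (lam m : ℝ) (k : ℕ) (c : ℝ) : ℝ :=
  Real.Gamma (lam * c + k) / Real.Gamma (lam * c) / (c + m) ^ k * (c / (c + m)) ^ (lam * c) *
    (Real.exp (lam * m) / lam ^ k)

lemma tendsto_gamma_ratio {lam : ℝ} (hlam : 0 < lam) (m : ℝ) (k : ℕ) :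
    Tendsto (fun c : ℝ => Real.Gamma (lam * c + k) / Real.Gamma (lam * c) / (c + m) ^ k) atTop
      (𝓝 (lam ^ k)) := by
  induction k with
  | zero =>
    refine tendsto_nhds_of_eventually_eq ?_
    filter_upwards [eventually_gt_atTop 0] with c hc
    simp [(Real.Gamma_pos_of_pos (mul_pos hlam hc)).ne']
  | succ k ih =>
    have h1 : Tendsto (fun c : ℝ => (lam * c + k) / (c + m)) atTop (𝓝 lam) := by
      have hinv : Tendsto (fun c : ℝ => (c + m)⁻¹) atTop (𝓝 0) :=
        tendsto_inv_atTop_zero.comp (tendsto_atTop_add_const_right _ _ tendsto_id)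
      have h2 : Tendsto (fun c : ℝ => lam + (k - lam * m) * (c + m)⁻¹) atTop
          (𝓝 (lam + (k - lam * m) * 0)) := (hinv.const_mul _).const_add _
      rw [mul_zero, add_zero] at h2
      refine h2.congr' ?_
      filter_upwards [eventually_gt_atTop (-m)] with c hc
      have : c + m ≠ 0 := by linarith
      field_simp
      ring
    rw [pow_succ]
    refine (ih.mul h1).congr' ?_
    filter_upwards [eventually_gt_atTop 0] with c hc
    have hG : Real.Gamma (lam * c + (k + 1 : ℕ)) = (lam * c + k) * Real.Gamma (lam * c + k) := by
      rw [← Real.Gamma_add_one (by positivity)]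
      push_cast
      ring_nf
    rw [hG, pow_succ]
    simp only [div_eq_mul_inv, mul_inv]
    ring

lemma tendsto_negBinPoissonRatio {lam : ℝ} (hlam : 0 < lam) {m : ℝ} (hm : 0 ≤ m) (k : ℕ) :
    Tendsto (negBinPoissonRatio lam m k) atTop (𝓝 1) := by
  have h1 : Tendsto (fun c : ℝ => (c / (c + m)) ^ (lam * c)) atTop
      (𝓝 ((Real.exp m)⁻¹ ^ lam)) := by
    have h2 := ((Real.tendsto_one_add_div_rpow_exp m).inv₀ (Real.exp_ne_zero m)).rpow_const
      (p := lam) (Or.inr hlam.le)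
    refine h2.congr' ?_
    filter_upwards [eventually_gt_atTop 0] with c hc
    have h3 : 1 + m / c = (c / (c + m))⁻¹ := by
      have : c + m ≠ 0 := by positivity
      field_simp
    have h4 : 0 ≤ c / (c + m) := by positivity
    rw [h3, Real.inv_rpow h4, inv_inv, ← Real.rpow_mul h4, mul_comm]
  have h5 := ((tendsto_gamma_ratio hlam m k).mul h1).mul_const (Real.exp (lam * m) / lam ^ k)
  refine (congrArg (fun y => Tendsto _ atTop (𝓝 y)) ?_).mp h5
  rw [← Real.exp_neg, ← Real.exp_mul, mul_assoc, ← mul_div_assoc, ← Real.exp_add]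
  have : -m * lam + lam * m = 0 := by ring
  rw [this, Real.exp_zero]
  field_simp

lemma negBin_fidi_eq_ratio_mul {lam c : ℝ} (hlam : 0 < lam) {l : ℕ} (x : Fin l → ℝ)
    (n : Fin l → ℕ) :
    Real.Gamma (lam * c + ((∑ i, n i : ℕ) : ℝ)) / Real.Gamma (lam * c) *
      (c / (c + ∑ j, x j)) ^ (lam * c) *
      ∏ i, (x i / (c + ∑ j, x j)) ^ n i / ((n i)! : ℝ) =
    negBinPoissonRatio lam (∑ j, x j) (∑ i, n i) c *
      ∏ i, Real.exp (-(lam * x i)) * (lam * x i) ^ n i / ((n i)! : ℝ) := by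
  have h1 : ∏ i, (x i / (c + ∑ j, x j)) ^ n i / ((n i)! : ℝ) =
      (∏ i, x i ^ n i / ((n i)! : ℝ)) / (c + ∑ j, x j) ^ (∑ i, n i) := by
    rw [← Finset.prod_pow_eq_pow_sum, ← Finset.prod_div_distrib]
    refine Finset.prod_congr rfl fun i _ => ?_
    rw [div_pow]
    ring
  have h2 : ∏ i, Real.exp (-(lam * x i)) * (lam * x i) ^ n i / ((n i)! : ℝ) =
      (Real.exp (lam * ∑ j, x j))⁻¹ * lam ^ (∑ i, n i) * ∏ i, x i ^ n i / ((n i)! : ℝ) := by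
    rw [← Finset.prod_pow_eq_pow_sum, Finset.mul_sum, Real.exp_sum, ← Finset.prod_inv_distrib,
      ← Finset.prod_mul_distrib, ← Finset.prod_mul_distrib]
    refine Finset.prod_congr rfl fun i _ => ?_
    rw [Real.exp_neg, mul_pow]
    ring
  rw [h1, h2, negBinPoissonRatio]
  have : lam ^ (∑ i, n i) ≠ 0 := by positivity
  field_simp

end Ratio

section Convergence

variable {S : Type*} [MetricSpace S] [MeasurableSpace S] [BorelSpace S]
  [TopologicalSpace.SeparableSpace S] [Nonempty S]

lemma IsPointProcessWithFidi.map_apply {Ω : Type*} [MeasurableSpace Ω] {P : Measure Ω}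
    [IsProbabilityMeasure P] {N : Ω → PointMeasure S}
    {p : (l : ℕ) → (Fin l → Set S) → (Fin l → ℕ) → ℝ} (h : IsPointProcessWithFidi N P p)
    {l : ℕ} {A : Fin l → Set S} (hA : ∀ i, MeasurableSet (A i))
    (hb : ∀ i, Bornology.IsBounded (A i)) (hd : Pairwise fun i j => Disjoint (A i) (A j))
    (n : Fin l → ℕ) :
    P.map N {ν | ∀ i, ν.toMeasure (A i) = (n i : ℝ≥0∞)} = ENNReal.ofReal (p l A n) := by
  rw [Measure.map_apply h.measurable (PointMeasure.measurableSet_forall_eq hA n),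
    ← h.fidi l A hA hb hd n, ofReal_measureReal]
  rfl

lemma tendstoInDistribution_of_isNegativeBinomialProcess {μ : Measure S} (hμ : BoundedlyFinite μ)
    {lam : ℝ} (hlam : 0 < lam) {Ω : Set.Ioi (0 : ℝ) → Type*} [∀ c, MeasurableSpace (Ω c)]
    {P : ∀ c, Measure (Ω c)} [∀ c, IsProbabilityMeasure (P c)] {N : ∀ c, Ω c → PointMeasure S}
    (hN : ∀ c, IsNegativeBinomialProcess (N c) (P c) (lam * (c : ℝ)) (c : ℝ) μ)
    {Ω' : Type*} [MeasurableSpace Ω'] {P' : Measure Ω'} [IsProbabilityMeasure P']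
    {M : Ω' → PointMeasure S} (hM : IsPoissonProcess M P' lam μ) :
    TendstoInDistribution N atTop M P P' where
  forall_aemeasurable c := (hN c).measurable.aemeasurable
  aemeasurable_limit := hM.measurable.aemeasurable
  tendsto := by
    have hfin : ∀ c, IsProbabilityMeasure ((P c).map (N c)) := fun c =>
      Measure.isProbabilityMeasure_map (hN c).measurable.aemeasurable
    have hfin' : IsProbabilityMeasure (P'.map M) :=
      Measure.isProbabilityMeasure_map hM.measurable.aemeasurable
    refine tendsto_of_forall_isOpen_le_liminf' fun G hG => ?_
    refine le_of_forall_lt_imp_le_of_dense fun a ha => ?_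
    refine le_liminf_of_le (by isBoundedDefault) ?_
    refine (PointMeasure.eventually_lt_measure_of_isOpen (Q := fun c => (P c).map (N c))
      (Q₀ := P'.map M) (fun B hB hBb => ?_) hG ha).mono fun c hc => hc.le
    refine ⟨fun k c => ENNReal.ofReal (negBinPoissonRatio lam (μ.real B) k c), fun k => ?_, ?_⟩
    · rw [← ENNReal.ofReal_one]
      exact (ENNReal.continuous_ofReal.tendsto 1).comp
        (tendsto_comp_val_Ioi_atTop.2 (tendsto_negBinPoissonRatio hlam measureReal_nonneg k))
    · rintro c k l A hA hd hU m rfl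
      have hb : ∀ i, Bornology.IsBounded (A i) := fun i =>
        hBb.subset (hU ▸ subset_iUnion A i)
      have hsum : μ.real B = ∑ j, μ.real (A j) := by
        have : ∀ j, μ (A j) ≠ ⊤ := fun j => (hμ _ (hb j)).ne
        rw [← hU, measureReal_def, measure_iUnion hd hA, tsum_fintype,
          ENNReal.toReal_sum fun j _ => this j]
        rfl
      have hpos : 0 ≤ ∏ i, Real.exp (-(lam * μ.real (A i))) * (lam * μ.real (A i)) ^ m i /
          ((m i)! : ℝ) := by positivity
      rw [(hN c).map_apply hA hb hd m, hM.map_apply hA hb hd m, ← ENNReal.ofReal_mul' hpos, hsum,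
        negBin_fidi_eq_ratio_mul hlam]

end Convergence

/-! ### Existence of the Poisson process -/

namespace PointMeasure

section Diracs

variable {S : Type*} [MetricSpace S] [MeasurableSpace S]

/-- The point measure `∑ j, δ_{x j}` of a finite configuration of points. -/
noncomputable def ofPoints {n : ℕ} (x : Fin n → S) : PointMeasure S where
  toMeasure := ∑ j, Measure.dirac (x j)
  boundedlyFinite _ _ := measure_lt_top _ _
  integerValued A hA _ := by
    classical
    refine ⟨∑ j, if x j ∈ A then 1 else 0, ?_⟩
    simp [hA, indicator_apply]

lemma measurable_ofPoints [BorelSpace S] [TopologicalSpace.SeparableSpace S] [Nonempty S] (n : ℕ) :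
    Measurable (ofPoints : (Fin n → S) → PointMeasure S) := by
  refine measurable_of_measurable_toMeasure (Measure.measurable_of_measurable_coe _ fun A hA => ?_)
  simp only [ofPoints, Measure.coe_finsetSum, Finset.sum_apply]
  exact Finset.measurable_fun_sum _ fun j _ =>
    (Measure.measurable_coe hA).comp (Measure.measurable_dirac.comp (measurable_pi_apply j))

/-- The exponential of a linear combination of the counts factorizes over the points. The factor is
written as `1 + ∑ i, 1_{A i} (e^{i t_i} - 1)`, which uses that the `A i` are disjoint. -/
lemma cexp_sum_ofPoints {n l : ℕ} (x : Fin n → S) {A : Fin l → Set S}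
    (hA : ∀ i, MeasurableSet (A i)) (hd : Pairwise fun i j => Disjoint (A i) (A j))
    (t : Fin l → ℝ) :
    Complex.exp ((∑ i, (ofPoints x).toMeasure.real (A i) * t i : ℝ) * Complex.I) =
      ∏ j, (1 + ∑ i, (A i).indicator (fun _ => Complex.exp (t i * Complex.I) - 1) (x j)) := by
  classical
  have h1 : ∀ i, (ofPoints x).toMeasure.real (A i) =
      ∑ j, (A i).indicator (fun _ => (1 : ℝ)) (x j) := by
    intro i
    simp only [ofPoints, measureReal_def, Measure.coe_finsetSum, Finset.sum_apply,
      Measure.dirac_apply' _ (hA i)]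
    rw [ENNReal.toReal_sum]
    · refine Finset.sum_congr rfl fun j _ => ?_
      by_cases h : x j ∈ A i <;> simp [h]
    · intro j _
      by_cases h : x j ∈ A i <;> simp [h]
  have h2 : ∑ i, (ofPoints x).toMeasure.real (A i) * t i =
      ∑ j, ∑ i, (A i).indicator (fun _ => t i) (x j) := by
    rw [Finset.sum_comm]
    refine Finset.sum_congr rfl fun i _ => ?_
    rw [h1, Finset.sum_mul]
    refine Finset.sum_congr rfl fun j _ => ?_
    by_cases h : x j ∈ A i <;> simp [h]
  rw [h2, Complex.ofReal_sum, Finset.sum_mul, Complex.exp_sum]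
  refine Finset.prod_congr rfl fun j _ => ?_
  by_cases h : ∃ i, x j ∈ A i
  · obtain ⟨i, hi⟩ := h
    have hne : ∀ i' ≠ i, x j ∉ A i' := fun i' hi' h' => Set.disjoint_left.1 (hd hi') h' hi
    rw [Finset.sum_eq_single i (fun i' _ h' => by simp [hne i' h']) (by simp),
      Finset.sum_eq_single i (fun i' _ h' => by simp [hne i' h']) (by simp)]
    simp [hi]
  · push Not at h
    simp [h]

end Diracs

lemma exists_isProbabilityMeasure_smul_eq {S : Type*} [MeasurableSpace S] [Nonempty S]
    (κ : Measure S) [IsFiniteMeasure κ] :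
    ∃ ρ : Measure S, IsProbabilityMeasure ρ ∧ κ = (κ univ).toNNReal • ρ := by
  by_cases h : κ = 0
  · obtain ⟨x⟩ := ‹Nonempty S›
    exact ⟨Measure.dirac x, inferInstance, by simp [h]⟩
  · have h0 : κ univ ≠ 0 := by simpa using h
    refine ⟨(κ univ)⁻¹ • κ, ⟨?_⟩, ?_⟩
    · simp [ENNReal.inv_mul_cancel h0 (measure_ne_top _ _)]
    · rw [ENNReal.smul_def, ENNReal.coe_toNNReal (measure_ne_top _ _), smul_smul,
        ENNReal.mul_inv_cancel h0 (measure_ne_top _ _), one_smul]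

section Annuli

variable {S : Type*} [MetricSpace S]

/-- The annulus `{x | k ≤ d(x, x₀) < k + 1}`. -/
def annulus (x₀ : S) (k : ℕ) : Set S := {x | ⌊dist x x₀⌋₊ = k}

lemma annulus_subset_ball (x₀ : S) (k : ℕ) :
    annulus x₀ k ⊆ Metric.ball x₀ (k + 1) := fun x hx => by
  have h := Nat.lt_floor_add_one (dist x x₀)
  rwa [show ⌊dist x x₀⌋₊ = k from hx] at h

lemma disjoint_annulus (x₀ : S) :
    Pairwise fun i j => Disjoint (annulus x₀ i) (annulus x₀ j) := fun _ _ hij =>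
  Set.disjoint_left.2 fun _ hi hj => hij (hi.symm.trans hj)

lemma iUnion_inter_annulus (x₀ : S) {A : Set S} {K : ℕ}
    (hK : A ⊆ Metric.ball x₀ K) : ⋃ k ∈ Finset.range K, A ∩ annulus x₀ k = A := by
  ext x
  simp only [mem_iUnion, Finset.mem_range, exists_prop, mem_inter_iff]
  exact ⟨fun ⟨_, _, h, _⟩ => h, fun h => ⟨⌊dist x x₀⌋₊,
    (Nat.floor_lt dist_nonneg).2 (hK h), h, rfl⟩⟩

lemma _root_.Bornology.IsBounded.exists_subset_ball_nat {A : Set S}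
    (hA : Bornology.IsBounded A) (x₀ : S) : ∃ K : ℕ, A ⊆ Metric.ball x₀ K := by
  obtain ⟨R, hR⟩ := hA.subset_ball x₀
  obtain ⟨K, hK⟩ := exists_nat_ge R
  exact ⟨K, hR.trans (Metric.ball_subset_ball hK)⟩

variable [MeasurableSpace S]

lemma sum_restrict_annulus_apply (ν : ℕ → Measure S) (x₀ : S) {A : Set S} (hA : MeasurableSet A)
    {K : ℕ} (hK : A ⊆ Metric.ball x₀ K) :
    Measure.sum (fun k => (ν k).restrict (annulus x₀ k)) A =
      ∑ k ∈ Finset.range K, ν k (A ∩ annulus x₀ k) := by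
  rw [Measure.sum_apply _ hA, tsum_eq_sum (s := Finset.range K)]
  · exact Finset.sum_congr rfl fun k _ => Measure.restrict_apply hA
  · intro k hk
    rw [Measure.restrict_apply hA]
    convert! measure_empty (μ := ν k)
    refine eq_empty_of_forall_notMem fun x hx => hk ?_
    rw [Finset.mem_range, ← show ⌊dist x x₀⌋₊ = k from hx.2]
    exact (Nat.floor_lt dist_nonneg).2 (hK hx.1)

variable [BorelSpace S] [TopologicalSpace.SeparableSpace S]

lemma measurableSet_annulus (x₀ : S) (k : ℕ) : MeasurableSet (annulus x₀ k) :=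
  (Nat.measurable_floor.comp (measurable_id.dist measurable_const)) (measurableSet_singleton k)

lemma measure_eq_sum_annulus (μ : Measure S) (x₀ : S) {A : Set S} (hA : MeasurableSet A) {K : ℕ}
    (hK : A ⊆ Metric.ball x₀ K) : μ A = ∑ k ∈ Finset.range K, μ (A ∩ annulus x₀ k) := by
  conv_lhs => rw [← iUnion_inter_annulus x₀ hK]
  refine measure_biUnion_finset (fun i _ j _ hij => ?_)
    fun k _ => hA.inter (measurableSet_annulus x₀ k)
  exact (disjoint_annulus x₀ hij).mono inter_subset_right inter_subset_right

/-- The superposition of the restrictions of the point measures `ν k` to the annuli around `x₀`. It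
is boundedly finite because a bounded set meets only finitely many annuli. -/
noncomputable def superpose (x₀ : S) (ν : ℕ → PointMeasure S) : PointMeasure S where
  toMeasure := Measure.sum fun k => (ν k).toMeasure.restrict (annulus x₀ k)
  boundedlyFinite A hA := by
    obtain ⟨K, hK⟩ := hA.exists_subset_ball_nat x₀
    refine (measure_mono hK).trans_lt ?_
    rw [sum_restrict_annulus_apply _ x₀ Metric.isOpen_ball.measurableSet Subset.rfl]
    exact ENNReal.sum_lt_top.2 fun k _ =>
      (ν k).boundedlyFinite _ (Metric.isBounded_ball.subset inter_subset_left)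
  integerValued A hA hb := by
    obtain ⟨K, hK⟩ := hb.exists_subset_ball_nat x₀
    choose n hn using fun k => (ν k).integerValued (A ∩ annulus x₀ k)
      (hA.inter (measurableSet_annulus x₀ k)) (hb.subset inter_subset_left)
    refine ⟨∑ k ∈ Finset.range K, n k, ?_⟩
    rw [sum_restrict_annulus_apply _ x₀ hA hK]
    simp [hn]

lemma superpose_real (x₀ : S) (ν : ℕ → PointMeasure S) {A : Set S} (hA : MeasurableSet A) {K : ℕ}
    (hK : A ⊆ Metric.ball x₀ K) : (superpose x₀ ν).toMeasure.real A =
      ∑ k ∈ Finset.range K, (ν k).toMeasure.real (A ∩ annulus x₀ k) := by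
  rw [measureReal_def, superpose, sum_restrict_annulus_apply _ x₀ hA hK, ENNReal.toReal_sum]
  · rfl
  · exact fun k _ => ((ν k).boundedlyFinite _
      (Metric.isBounded_ball.subset (inter_subset_left.trans hK))).ne

end Annuli

section Existence

variable {S : Type*} [MetricSpace S] [MeasurableSpace S] [BorelSpace S]
variable [TopologicalSpace.SeparableSpace S] [Nonempty S]

lemma measurable_real_toMeasure {B : Set S} (hB : MeasurableSet B) :
    Measurable fun ν : PointMeasure S => ν.toMeasure.real B :=
  ((Measure.measurable_coe hB).comp measurable_toMeasure).ennreal_toReal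

/-- The law of the Poisson process with finite intensity `κ`: a Poisson number of independent points
with law `κ / κ(S)`. It is described by the joint characteristic function of its counts. -/
lemma exists_poisson_of_isFiniteMeasure (κ : Measure S) [IsFiniteMeasure κ] :
    ∃ π : Measure (PointMeasure S), IsProbabilityMeasure π ∧
      ∀ (l : ℕ) (A : Fin l → Set S), (∀ i, MeasurableSet (A i)) →
        (Pairwise fun i j => Disjoint (A i) (A j)) → ∀ t : Fin l → ℝ,
        ∫ ν, Complex.exp ((∑ i, ν.toMeasure.real (A i) * t i : ℝ) * Complex.I) ∂π =
          Complex.exp (∑ i, κ.real (A i) * (Complex.exp (t i * Complex.I) - 1)) := by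
  obtain ⟨ρ, hρ, hκ⟩ := exists_isProbabilityMeasure_smul_eq κ
  set m : ℝ≥0 := (κ univ).toNNReal
  set w : ℕ → ℝ≥0∞ := fun n => ENNReal.ofReal (Real.exp (-m) * m ^ n / (n)!)
  set π : Measure (PointMeasure S) :=
    Measure.sum fun n => w n • (Measure.pi fun _ : Fin n => ρ).map ofPoints
  have hprob : ∀ n, IsProbabilityMeasure ((Measure.pi fun _ : Fin n => ρ).map ofPoints) :=
    fun n => Measure.isProbabilityMeasure_map (measurable_ofPoints n).aemeasurable
  have hw : ∑' n, w n = 1 := by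
    have h := hasSum_one_poissonMeasure m
    rw [← ENNReal.ofReal_tsum_of_nonneg (fun n => by positivity) h.summable, h.tsum_eq,
      ENNReal.ofReal_one]
  have hπ : IsProbabilityMeasure π := ⟨by simp [π, Measure.sum_apply, hw]⟩
  refine ⟨π, hπ, fun l A hA hd t => ?_⟩
  have hmeas : Measurable fun ν : PointMeasure S =>
      Complex.exp ((∑ i, ν.toMeasure.real (A i) * t i : ℝ) * Complex.I) := by
    have := fun i => measurable_real_toMeasure (hA i)
    fun_prop
  have hint : Integrable (fun ν : PointMeasure S =>
      Complex.exp ((∑ i, ν.toMeasure.real (A i) * t i : ℝ) * Complex.I)) π :=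
    Integrable.of_bound hmeas.aestronglyMeasurable 1
      (ae_of_all _ fun ν => (Complex.norm_exp_ofReal_mul_I _).le)
  set z : ℂ := 1 + ∑ i, (ρ.real (A i) : ℂ) * (Complex.exp (t i * Complex.I) - 1)
  have hz : ∫ y, (1 + ∑ i, (A i).indicator (fun _ => Complex.exp (t i * Complex.I) - 1) y) ∂ρ =
      z := by
    have hi : ∀ i, Integrable ((A i).indicator fun _ : S => Complex.exp (t i * Complex.I) - 1) ρ :=
      fun i => (integrable_const _).indicator (hA i)
    rw [integral_add (integrable_const _) (integrable_finsetSum _ fun i _ => hi i),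
      integral_finsetSum _ fun i _ => hi i]
    simp [integral_indicator_const, hA, z]
  have hterm : ∀ n, ∫ ν, Complex.exp ((∑ i, ν.toMeasure.real (A i) * t i : ℝ) * Complex.I)
      ∂(w n • (Measure.pi fun _ : Fin n => ρ).map ofPoints) =
      Complex.exp (-m) * ((m * z) ^ n / (n)!) := by
    intro n
    rw [integral_smul_measure, integral_map (measurable_ofPoints n).aemeasurable
      hmeas.aestronglyMeasurable]
    simp_rw [cexp_sum_ofPoints _ hA hd t]
    rw [integral_fintype_prod_eq_pow (ι := Fin n)
      (fun y => 1 + ∑ i, (A i).indicator (fun _ => Complex.exp (t i * Complex.I) - 1) y), hz,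
      ENNReal.toReal_ofReal (by positivity), Fintype.card_fin, Complex.real_smul]
    push_cast
    rw [mul_pow]
    field_simp
  have hsum := hasSum_integral_measure hint
  simp_rw [hterm] at hsum
  have hexp := (NormedSpace.expSeries_div_hasSum_exp (m * z : ℂ)).mul_left (Complex.exp (-m))
  rw [← Complex.exp_eq_exp_ℂ, ← Complex.exp_add] at hexp
  rw [hsum.unique hexp]
  congr 1
  have hκA : ∀ i, (κ.real (A i) : ℂ) = m * ρ.real (A i) := fun i => by
    rw [hκ]
    simp [measureReal_def]
  simp_rw [hκA, mul_assoc, ← Finset.mul_sum]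
  simp only [z, mul_add, mul_one, neg_add_cancel_left]

lemma measurable_superpose (x₀ : S) :
    Measurable (superpose x₀ : (ℕ → PointMeasure S) → PointMeasure S) := by
  refine measurable_of_measurable_toMeasure (Measure.measurable_of_measurable_coe _ fun A hA => ?_)
  simp only [superpose, Measure.sum_apply _ hA, Measure.restrict_apply hA]
  exact Measurable.tsum fun k =>
    (Measure.measurable_coe (hA.inter (measurableSet_annulus x₀ k))).comp
      (measurable_toMeasure.comp (measurable_pi_apply k))

lemma measurable_toLp_counts {l : ℕ} {A : Fin l → Set S} (hA : ∀ i, MeasurableSet (A i)) :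
    Measurable fun ν : PointMeasure S => WithLp.toLp 2 fun i => ν.toMeasure.real (A i) :=
  (WithLp.measurable_toLp 2 _).comp
    (measurable_pi_lambda _ fun i => measurable_real_toMeasure (hA i))

lemma charFun_map_toLp_counts {π : Measure (PointMeasure S)} {l : ℕ} {A : Fin l → Set S}
    (hA : ∀ i, MeasurableSet (A i)) (t : EuclideanSpace ℝ (Fin l)) :
    charFun (π.map fun ν => WithLp.toLp 2 fun i => ν.toMeasure.real (A i)) t =
      ∫ ν, Complex.exp ((∑ i, ν.toMeasure.real (A i) * t i : ℝ) * Complex.I) ∂π := by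
  rw [charFun_apply, integral_map (measurable_toLp_counts hA).aemeasurable (by fun_prop)]
  refine integral_congr_ae (ae_of_all _ fun ν => ?_)
  simp [PiLp.inner_apply, mul_comm]

/-- The counts of the superposition of independent Poisson processes with intensities
`lam • μ` on the annuli have the characteristic function of independent Poisson variables. -/
lemma map_superpose_eq_pi {μ : Measure S} (hμ : BoundedlyFinite μ) (lam : ℝ≥0) (x₀ : S)
    {π : ℕ → Measure (PointMeasure S)} [∀ k, IsProbabilityMeasure (π k)]
    (hπ : ∀ k (l : ℕ) (A : Fin l → Set S), (∀ i, MeasurableSet (A i)) →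
        (Pairwise fun i j => Disjoint (A i) (A j)) → ∀ t : Fin l → ℝ,
        ∫ ν, Complex.exp ((∑ i, ν.toMeasure.real (A i) * t i : ℝ) * Complex.I) ∂(π k) =
          Complex.exp (∑ i, (lam • μ.restrict (annulus x₀ k)).real (A i) *
            (Complex.exp (t i * Complex.I) - 1)))
    {l : ℕ} {A : Fin l → Set S} (hA : ∀ i, MeasurableSet (A i))
    (hb : ∀ i, Bornology.IsBounded (A i)) (hd : Pairwise fun i j => Disjoint (A i) (A j)) :
    (Measure.infinitePi π).map (fun ω i => (superpose x₀ ω).toMeasure.real (A i)) =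
      Measure.pi fun i => (poissonMeasure (lam * (μ (A i)).toNNReal)).map (Nat.cast : ℕ → ℝ) := by
  obtain ⟨K, hK⟩ : ∃ K : ℕ, ∀ i, A i ⊆ Metric.ball x₀ K := by
    obtain ⟨K, hK⟩ := ((Bornology.isBounded_iUnion).2 hb).exists_subset_ball_nat x₀
    exact ⟨K, fun i => (subset_iUnion A i).trans hK⟩
  have hAk : ∀ k i, MeasurableSet (A i ∩ annulus x₀ k) := fun k i =>
    (hA i).inter (measurableSet_annulus x₀ k)
  -- the contribution of the `k`-th annulus to the vector of counts
  let X : ℕ → PointMeasure S → EuclideanSpace ℝ (Fin l) := fun k ν =>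
    WithLp.toLp 2 fun i => ν.toMeasure.real (A i ∩ annulus x₀ k)
  have hX : ∀ k, Measurable (X k) := fun k => measurable_toLp_counts (hAk k)
  have hV : Measurable fun (ω : ℕ → PointMeasure S) i => (superpose x₀ ω).toMeasure.real (A i) :=
    measurable_pi_lambda _ fun i =>
      (measurable_real_toMeasure (hA i)).comp (measurable_superpose x₀)
  have hprob : ∀ i, IsProbabilityMeasure
      ((poissonMeasure (lam * (μ (A i)).toNNReal)).map (Nat.cast : ℕ → ℝ)) := fun i =>
    Measure.isProbabilityMeasure_map Measurable.of_discrete.aemeasurable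
  have hprob' := Measure.isProbabilityMeasure_map (μ := Measure.infinitePi π) hV.aemeasurable
  refine charFun_eq_pi_iff.1 fun t => ?_
  have hsum : (WithLp.toLp 2 ∘ fun (ω : ℕ → PointMeasure S) i =>
      (superpose x₀ ω).toMeasure.real (A i)) = fun ω => ∑ k ∈ Finset.range K, X k (ω k) := by
    ext ω i
    simp [X, superpose_real x₀ ω (hA i) (hK i)]
  have hind : iIndepFun (fun k (ω : ℕ → PointMeasure S) => X k (ω k)) (Measure.infinitePi π) :=
    iIndepFun_infinitePi hX
  have hk : ∀ k, charFun ((Measure.infinitePi π).map fun ω => X k (ω k)) t =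
      Complex.exp (∑ i, ((lam * μ.real (A i ∩ annulus x₀ k) : ℝ) : ℂ) *
        (Complex.exp (t i * Complex.I) - 1)) := by
    intro k
    have h1 : (Measure.infinitePi π).map (fun ω => X k (ω k)) = (π k).map (X k) := by
      rw [← Measure.infinitePi_map_eval π k, Measure.map_map (hX k) (measurable_pi_apply k)]
      rfl
    rw [h1, charFun_map_toLp_counts (hAk k), hπ k l _ (hAk k)
      fun i j hij => (hd hij).mono inter_subset_left inter_subset_left]
    congr 1
    refine Finset.sum_congr rfl fun i _ => ?_
    simp [measureReal_def, Measure.restrict_apply (hAk k i), inter_assoc]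
  have hchar := iIndepFun.charFun_map_fun_finsetSum_eq_prod (s := Finset.range K)
    (X := fun k (ω : ℕ → PointMeasure S) => X k (ω k)) (P := Measure.infinitePi π)
    (fun k _ => ((hX k).comp (measurable_pi_apply k)).aemeasurable) (hind.restrict (Finset.range K))
  rw [Measure.map_map (WithLp.measurable_toLp 2 _) hV, hsum, hchar, Finset.prod_apply]
  simp_rw [hk, charFun_map_cast_poissonMeasure]
  rw [← Complex.exp_sum, ← Complex.exp_sum, Finset.sum_comm]
  congr 1
  refine Finset.sum_congr rfl fun i _ => ?_
  rw [← Finset.sum_mul]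
  congr 1
  have h3 : μ.real (A i) = ∑ k ∈ Finset.range K, μ.real (A i ∩ annulus x₀ k) := by
    rw [measureReal_def, measure_eq_sum_annulus μ x₀ (hA i) (hK i), ENNReal.toReal_sum]
    · rfl
    · exact fun k _ => (hμ _ ((hb i).subset inter_subset_left)).ne
  have h4 : ((lam * (μ (A i)).toNNReal : ℝ≥0) : ℝ) = lam * μ.real (A i) := rfl
  rw [← Complex.ofReal_sum, ← Finset.mul_sum, ← h3, ← h4]

lemma exists_isPoissonProcess {μ : Measure S} (hμ : BoundedlyFinite μ) {lam : ℝ} (hlam : 0 ≤ lam) :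
    ∃ Q : ProbabilityMeasure (PointMeasure S),
      IsPoissonProcess (id : PointMeasure S → PointMeasure S) (Q : Measure (PointMeasure S))
        lam μ := by
  lift lam to ℝ≥0 using hlam
  obtain ⟨x₀⟩ := ‹Nonempty S›
  have : Nonempty S := ⟨x₀⟩
  have hfin : ∀ k, IsFiniteMeasure (lam • μ.restrict (annulus x₀ k)) := fun k => by
    have : IsFiniteMeasure (μ.restrict (annulus x₀ k)) :=
      ⟨by simpa using hμ _ (Metric.isBounded_ball.subset (annulus_subset_ball x₀ k))⟩
    infer_instance
  choose π hprob hπ using fun k =>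
    exists_poisson_of_isFiniteMeasure (lam • μ.restrict (annulus x₀ k))
  refine ⟨⟨(Measure.infinitePi π).map (superpose x₀),
    Measure.isProbabilityMeasure_map (measurable_superpose x₀).aemeasurable⟩, measurable_id,
    fun l A hA hb hd n => ?_⟩
  have hmap := map_superpose_eq_pi hμ lam x₀ hπ hA hb hd
  have hV : Measurable fun (ω : ℕ → PointMeasure S) i => (superpose x₀ ω).toMeasure.real (A i) :=
    measurable_pi_lambda _ fun i =>
      (measurable_real_toMeasure (hA i)).comp (measurable_superpose x₀)
  have hset : superpose x₀ ⁻¹' {ν | ∀ i, ν.toMeasure (A i) = (n i : ℝ≥0∞)} =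
      (fun (ω : ℕ → PointMeasure S) i => (superpose x₀ ω).toMeasure.real (A i)) ⁻¹'
        (Set.pi univ fun i => {(n i : ℝ)}) := by
    ext ω
    simp only [mem_preimage, mem_ofPred_eq, mem_univ_pi, mem_singleton_iff, measureReal_def]
    refine forall_congr' fun i => ?_
    rw [← ENNReal.toReal_natCast (n i), ENNReal.toReal_eq_toReal_iff'
      ((superpose x₀ ω).boundedlyFinite _ (hb i)).ne (ENNReal.natCast_ne_top _)]
  have hsing : ∀ i, (Nat.cast : ℕ → ℝ) ⁻¹' {(n i : ℝ)} = {n i} := fun i => by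
    ext j
    simp
  have hmeas := measurableSet_forall_eq hA n
  rw [measureReal_def]
  change ((Measure.infinitePi π).map (superpose x₀)
    {ν | ∀ i, ν.toMeasure (A i) = (n i : ℝ≥0∞)}).toReal = _
  rw [Measure.map_apply (measurable_superpose x₀) hmeas, hset,
    ← Measure.map_apply hV (MeasurableSet.univ_pi fun i => measurableSet_singleton _), hmap,
    Measure.pi_pi, ENNReal.toReal_prod]
  refine Finset.prod_congr rfl fun i _ => ?_
  rw [Measure.map_apply (by fun_prop) (measurableSet_singleton _), hsing, ← measureReal_def,
    poissonMeasure_real_singleton]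
  rfl

end Existence

end PointMeasure

/-! ### The empty space and the conclusion -/

section EmptySpace

variable {S : Type*} [MetricSpace S] [MeasurableSpace S] [IsEmpty S]

instance : Subsingleton (PointMeasure S) :=
  ⟨fun _ _ => PointMeasure.ext (Subsingleton.elim _ _)⟩

lemma exists_isPoissonProcess_of_isEmpty (μ : Measure S) (lam : ℝ) :
    ∃ Q : ProbabilityMeasure (PointMeasure S),
      IsPoissonProcess (id : PointMeasure S → PointMeasure S) (Q : Measure (PointMeasure S))
        lam μ := by
  classical
  let ν₀ : PointMeasure S := ⟨0, fun _ _ => by simp, fun _ _ _ => ⟨0, by simp⟩⟩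
  refine ⟨⟨Measure.dirac ν₀, inferInstance⟩, measurable_id, fun l A _ _ _ n => ?_⟩
  have hμ : μ = 0 := Subsingleton.elim _ _
  have hset : {ν : PointMeasure S | ∀ i, (id ν).toMeasure (A i) = (n i : ℝ≥0∞)} =
      if ∀ i, n i = 0 then univ else ∅ := by
    ext ν
    have hν : ν.toMeasure = 0 := Subsingleton.elim _ _
    split_ifs with h
    · simp [hν, h]
    · simpa [hν, eq_comm] using h
  rw [hset, hμ]
  change (Measure.dirac ν₀).real _ = _
  split_ifs with h
  · simp [h]
  · push Not at h
    obtain ⟨i, hi⟩ := h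
    rw [measureReal_empty, eq_comm]
    exact Finset.prod_eq_zero (Finset.mem_univ i) (by simp [hi])

end EmptySpace

theorem theorem14 {S : Type*} [MetricSpace S] [CompleteSpace S]
    [TopologicalSpace.SeparableSpace S] [MeasurableSpace S] [BorelSpace S]
    (μ : Measure S) (hμ : BoundedlyFinite μ) (lam : ℝ) (hlam : 0 < lam)
    {Ω : Set.Ioi (0 : ℝ) → Type*} [∀ c, MeasurableSpace (Ω c)]
    (P : ∀ c, Measure (Ω c)) [∀ c, IsProbabilityMeasure (P c)]
    (N : ∀ c, Ω c → PointMeasure S)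
    (hN : ∀ c, IsNegativeBinomialProcess (N c) (P c) (lam * (c : ℝ)) (c : ℝ) μ) :
    (∃ Q : ProbabilityMeasure (PointMeasure S),
      IsPoissonProcess (id : PointMeasure S → PointMeasure S) (Q : Measure (PointMeasure S))
        lam μ) ∧
    ∀ {Ω' : Type*} [MeasurableSpace Ω'] (P' : Measure Ω') [IsProbabilityMeasure P']
      (M : Ω' → PointMeasure S), IsPoissonProcess M P' lam μ →
      TendstoInDistribution N atTop M P P' := by
  rcases isEmpty_or_nonempty S with hS | hS
  · refine ⟨exists_isPoissonProcess_of_isEmpty μ lam, fun P' _ M hM => ⟨fun c =>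
      (hN c).measurable.aemeasurable, hM.measurable.aemeasurable, ?_⟩⟩
    -- the space of point measures is a singleton, so that all laws on it agree
    refine tendsto_nhds_of_eventually_eq (Eventually.of_forall fun c => Subtype.ext ?_)
    have := Measure.isProbabilityMeasure_map (μ := P c) (hN c).measurable.aemeasurable
    have := Measure.isProbabilityMeasure_map (μ := P') hM.measurable.aemeasurable
    refine Measure.ext fun s _ => ?_
    rcases s.eq_empty_or_nonempty with h | h
    · simp [h]
    · rw [Subsingleton.eq_univ_of_nonempty h]
      exact measure_univ.trans measure_univ.symm
  · exact ⟨PointMeasure.exists_isPoissonProcess hμ hlam.le, fun P' _ M hM =>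
      tendstoInDistribution_of_isNegativeBinomialProcess hμ hlam hN hM⟩
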